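/- Let $\mathcal X$ be a measurable space with a $\sigma$-finite base measure, written $dx$ (e.g. Lebesgue or counting measure), and let $\phi:\mathcal X^2\to\mathbb R$ be a measurable Mercer kernel (every matrix $(\phi(x^{(i)},x^{(j)}))_{i,j}$ is symmetric positive semidefinite) with $\int_{\mathcal X}\exp(-c\,\phi(x,x))\,dx<\infty$ for every $c>0$. Put $f(x)=-\phi(x,x)$, let $p\ge 1$, and for $\theta=(\theta_{st})_{1\le s<t\le p}\in\mathbb R^{p(p-1)/2}$ consider the density on $\mathcal X^p$ $$\mathbb P(x;\theta)=\exp\Big\{\sum_{s=1}^p f(x_s)+\sum_{s<t}\theta_{st}\,\phi(x_s,x_t)-A(\theta)\Big\},\qquad A(\theta)=\log\int_{\mathcal X^p}\exp\Big\{\sum_s f(x_s)+\sum_{s<t}\theta_{st}\phi(x_s,x_t)\Big\}dx .$$ Let $\theta^*$ be a parameter vector with $|\theta^*_{st}|\le 0.25$ for all $s<t$, such that the model has minimal representation: no other parameter vector $\theta$ with $A(\theta)<\infty$ gives the same distribution as $\theta^*$. If the graph $\{(s,t):\theta^*_{st}\neq 0\}$ has a vertex of degree at least $8$, assume also that $A$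 is finite in a neighbourhood of $\theta^*$ (so that the gradient of the likelihood at $\theta^*$ exists; when all degrees are at most $7$ this follows from the other assumptions). For an i.i.d. sample $\mathbb X_n=(X^{(1)},\dots,X^{(n)})$ from $\mathbb P(\cdot\,;\theta^*)$ let $L(\theta;\mathbb X_n)=-\frac1n\sum_{i=1}^n\log\mathbb P(X^{(i)};\theta)$ (with $L=+\infty$ where $A(\theta)=+\infty$), let $\gamma_n=\|\nabla L(\theta^*;\mathbb X_n)\|_\infty$ be the largest absolute value of a partial derivative $\partial L/\partial\theta_{st}$ at $\theta^*$ ($\gamma_n=0$ if $p=1$), and let $$\hat\theta_n=\arg\min_\theta\{L(\theta;\mathbb X_n)+\lambda_n\|\theta\|_1\}.$$ Then there are constants $\sigma,\zeta,r,\beta>0$, which do not depend on $n$, such that for every $c_0\ge 2$ and every $$n>\max\Big(\frac{6\ln p}{\sigma^2\zeta^2},\;13.5\,c_0^2r^{-2}\beta^{-2}\sigma^2\|\theta^*\|_0\ln p\Big)$$ the following holds with probability at least $1-2p^{-1}$: for every $\lambda_n\in[2\gamma_n,c_0\gamma_n]$ the minimizer $\hat\theta_n$ exists, is unique, and satisfies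 $$\|\hat\theta_n-\theta^*\|\le 1.5\,c_0\,\beta^{-1}\sigma\sqrt{6\,\|\theta^*\|_0\ln p/n}.$$ Here $\|\theta\|$ is the Euclidean norm, $\|\theta\|_1=\sum_{s<t}|\theta_{st}|$, and $\|\theta\|_0$ is the number of nonzero entries of $\theta$. -/

import Mathlib

open MeasureTheory ProbabilityTheory

universe u w

namespace SemiEFGM

/-- The unordered pairs of distinct vertices of `{1, …, p}`, written with the smaller one first. -/
abbrev Pairs (p : ℕ) : Type := {e : Fin p × Fin p // e.1 < e.2}

/-- The pairwise parameters `θ = (θ_st)` of the model, with the Euclidean norm. -/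
abbrev Param (p : ℕ) : Type := EuclideanSpace ℝ (Pairs p)

/-- The number of nonzero entries of `θ`. -/
noncomputable def l0 {p : ℕ} (θ : Param p) : ℕ := (Finset.univ.filter fun e => θ e ≠ 0).card

/-- The sum of the absolute values of the entries of `θ`. -/
noncomputable def l1 {p : ℕ} (θ : Param p) : ℝ := ∑ e, |θ e|

/-- The degree of the vertex `s` in the graph whose edges are the pairs with `θ_st ≠ 0`. -/
noncomputable def degree {p : ℕ} (θ : Param p) (s : Fin p) : ℕ :=
  (Finset.univ.filter fun e : Pairs p => θ e ≠ 0 ∧ (e.1.1 = s ∨ e.1.2 = s)).card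

/-- Mercer kernels: all the matrices `φ (x i) (x j)` are (symmetric) positive semidefinite. -/
def IsMercerKernel {𝒳 : Type*} (φ : 𝒳 → 𝒳 → ℝ) : Prop :=
  ∀ (m : ℕ) (x : Fin m → 𝒳), (Matrix.of fun i j => φ (x i) (x j)).PosSemidef

section Model

variable {𝒳 : Type*} {p : ℕ}

/-- The exponent `∑_s f(x_s) + ∑_{s<t} θ_st φ(x_s, x_t)` of the density. -/
noncomputable def energy (f : 𝒳 → ℝ) (φ : 𝒳 → 𝒳 → ℝ) (θ : Param p) (x : Fin p → 𝒳) : ℝ :=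
  ∑ s, f (x s) + ∑ e : Pairs p, θ e * φ (x e.1.1) (x e.1.2)

variable [MeasurableSpace 𝒳] (ν : Measure 𝒳) (f : 𝒳 → ℝ) (φ : 𝒳 → 𝒳 → ℝ)

/-- The parameters `θ` at which the log-partition function is finite, `A(θ) < ∞`. -/
def domain : Set (Param p) :=
  {θ | Integrable (fun x => Real.exp (energy f φ θ x)) (Measure.pi fun _ : Fin p => ν)}

/-- The log-partition function `A(θ)`; meaningful for `θ` in `domain`. -/
noncomputable def logPartition (θ : Param p) : ℝ :=
  Real.log (∫ x, Real.exp (energy f φ θ x) ∂(Measure.pi fun _ : Fin p => ν))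

/-- The density of the model with respect to the product base measure. -/
noncomputable def density (θ : Param p) (x : Fin p → 𝒳) : ℝ :=
  Real.exp (energy f φ θ x - logPartition ν f φ θ)

/-- The distribution of the model with parameter `θ`. -/
noncomputable def law (θ : Param p) : Measure (Fin p → 𝒳) :=
  (Measure.pi fun _ : Fin p => ν).withDensity fun x => ENNReal.ofReal (density ν f φ θ x)

/-- The distribution with parameter `θ` has minimal representation: `θ` is the only parameter
vector that gives this distribution. -/
def MinimalRepresentation (θ : Param p) : Prop :=
  ∀ θ' ∈ domain ν f φ, law ν f φ θ' = law ν f φ θ → θ' = θ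

/-- The normalized negative log-likelihood `L(θ; x)` of the sample `x 1, …, x n`. -/
noncomputable def negLogLik {n : ℕ} (x : Fin n → Fin p → 𝒳) (θ : Param p) : ℝ :=
  -(1 / (n : ℝ)) * ∑ i, Real.log (density ν f φ θ (x i))

/-- The sup-norm `‖∇L(θ; x)‖_∞` of the vector of the partial derivatives `∂L/∂θ_st`. -/
noncomputable def gradSupNorm {n : ℕ} (x : Fin n → Fin p → 𝒳) (θ : Param p) : ℝ :=
  ⨆ e : Pairs p, |lineDeriv ℝ (negLogLik ν f φ x) θ (EuclideanSpace.single e 1)|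

/-- `θ` is a global minimizer of `L(·; x) + lam ‖·‖₁`, where `L = +∞` outside `domain`. -/
def IsJointEstimator {n : ℕ} (x : Fin n → Fin p → 𝒳) (lam : ℝ) (θ : Param p) : Prop :=
  θ ∈ domain ν f φ ∧ ∀ θ' ∈ domain ν f φ,
    negLogLik ν f φ x θ + lam * l1 θ ≤ negLogLik ν f φ x θ' + lam * l1 θ'

end Model

end SemiEFGM

/-!
The negative log-likelihood `L` is the log-partition function minus a linear function of `θ`. If
`⟪v, suffStat φ⟫` were almost everywhere constant, moving `θ*` along `v` would not change the
distribution, so minimal representation makes the sufficient statistic nondegenerate. Hence `L` is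
strictly convex, and near `θ*` it exceeds its tangent by `β ‖θ - θ*‖ ^ 2`; the data enter only
through the linear part, so `β` and the radius `r` of this growth depend neither on `n` nor on the
sample.

The gradient of `L` at `θ*` is the mean of the sufficient statistic minus its sample mean. As `θ*`
is interior to the domain, every component is sub-exponential, and Chernoff's bound together with a
union bound over at most `p ^ 2` pairs gives `γ ≤ σ √(6 log p / n)` off an event of probability at
most `2 / p`. Since `lam` dominates `2 γ`, the penalized linear part of `L` costs at most
`1.5 lam √‖θ*‖₀ ‖θ - θ*‖`, which the quadratic growth outweighs on the sphere of radius `r`. So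
there is a minimizer inside the ball, and strict convexity makes it the only one.

For a Mercer kernel `|φ(y, z)| ≤ (φ(y, y) + φ(z, z)) / 2`, so the energy is at most
`-∑ (1 - w_s / 2) φ(x_s, x_s)` with `w_s` the weighted degree of `s`. Entries of size at most `1/4`
and degrees at most `7` keep `w_s < 2`, also for nearby parameters, so `θ*` is interior to the
domain.
-/

namespace SemiEFGM

open Metric Set Filter Topology
open scoped Finset RealInnerProductSpace

section Lasso

variable {ι : Type*} [Fintype ι]

lemma sum_abs_le_sqrt_card_mul_norm (s : Finset ι) (v : EuclideanSpace ℝ ι) :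
    ∑ e ∈ s, |v e| ≤ √(#s : ℝ) * ‖v‖ := by
  rw [EuclideanSpace.norm_eq, ← Real.sqrt_mul (by positivity)]
  refine Real.le_sqrt_of_sq_le (sq_sum_le_card_mul_sum_sq.trans ?_)
  simp only [sq_abs, Real.norm_eq_abs]
  gcongr
  exact s.subset_univ

lemma neg_ite_le_mul_sub_add_mul_abs_sub_abs {a b g lam : ℝ} (hg : 2 * |g| ≤ lam) :
    -(if a ≠ 0 then 1.5 * lam * |b - a| else 0) ≤ g * (b - a) + lam * (|b| - |a|) := by
  have hlin : -(lam / 2 * |b - a|) ≤ g * (b - a) := by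
    refine (neg_le_neg ?_).trans (neg_abs_le _)
    rw [abs_mul]
    gcongr
    linarith
  have hlam : 0 ≤ lam := (by positivity : 0 ≤ 2 * |g|).trans hg
  by_cases ha : a = 0
  · simp only [ha, sub_zero, abs_zero, ne_eq, not_true_eq_false, if_false] at hlin ⊢
    linarith [mul_nonneg hlam (abs_nonneg b)]
  · have htri : lam * (|a| - |b|) ≤ lam * |b - a| := by
      gcongr
      exact abs_sub_comm b a ▸ abs_sub_abs_le_abs_sub a b
    rw [if_pos ha]
    linarith

lemma neg_mul_norm_le_inner_add_l1_sub {θ₀ θ g : EuclideanSpace ℝ ι} {lam : ℝ} (hlam : 0 ≤ lam)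
    (hg : ∀ e, 2 * |g e| ≤ lam) :
    -(1.5 * lam * √(#{e | θ₀ e ≠ 0} : ℝ) * ‖θ - θ₀‖) ≤
      ⟪g, θ - θ₀⟫ + lam * (∑ e, |θ e| - ∑ e, |θ₀ e|) := by
  calc -(1.5 * lam * √(#{e | θ₀ e ≠ 0} : ℝ) * ‖θ - θ₀‖)
      ≤ -(1.5 * lam * ∑ e with θ₀ e ≠ 0, |(θ - θ₀) e|) := by
        rw [mul_assoc]
        gcongr
        exact sum_abs_le_sqrt_card_mul_norm _ _
    _ = ∑ e, -(if θ₀ e ≠ 0 then 1.5 * lam * |θ e - θ₀ e| else 0) := by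
        rw [Finset.sum_neg_distrib, ← Finset.sum_filter, Finset.mul_sum]
        rfl
    _ ≤ ∑ e, (g e * (θ e - θ₀ e) + lam * (|θ e| - |θ₀ e|)) :=
        Finset.sum_le_sum fun e _ => neg_ite_le_mul_sub_add_mul_abs_sub_abs (hg e)
    _ = ⟪g, θ - θ₀⟫ + lam * (∑ e, |θ e| - ∑ e, |θ₀ e|) := by
        rw [Finset.sum_add_distrib, ← Finset.mul_sum, Finset.sum_sub_distrib, PiLp.inner_apply]
        simp only [RCLike.inner_apply, conj_trivial, PiLp.sub_apply, mul_comm]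

lemma convexOn_sum_abs : ConvexOn ℝ univ fun θ : EuclideanSpace ℝ ι => ∑ e, |θ e| := by
  refine ⟨convex_univ, fun x _ y _ a b ha hb _ => ?_⟩
  simp only [smul_eq_mul, Finset.mul_sum, ← Finset.sum_add_distrib]
  refine Finset.sum_le_sum fun e _ => (abs_add_le _ _).trans_eq ?_
  simp [abs_mul, abs_of_nonneg ha, abs_of_nonneg hb]

lemma norm_sub_le_of_l1_penalized_le {L : EuclideanSpace ℝ ι → ℝ} {θ₀ θ g : EuclideanSpace ℝ ι}
    {β lam : ℝ} (hβ : 0 < β) (hlam : 0 ≤ lam) (hg : ∀ e, 2 * |g e| ≤ lam)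
    (hgrowth : β * ‖θ - θ₀‖ ^ 2 ≤ L θ - L θ₀ - ⟪g, θ - θ₀⟫)
    (hle : L θ + lam * ∑ e, |θ e| ≤ L θ₀ + lam * ∑ e, |θ₀ e|) :
    ‖θ - θ₀‖ ≤ 1.5 * lam * √(#{e | θ₀ e ≠ 0} : ℝ) / β := by
  have hpen := neg_mul_norm_le_inner_add_l1_sub (θ₀ := θ₀) (θ := θ) hlam hg
  rw [le_div_iff₀ hβ]
  rcases (norm_nonneg (θ - θ₀)).eq_or_lt with h0 | hpos
  · rw [← h0, zero_mul]
    positivity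
  · refine le_of_mul_le_mul_right ?_ hpos
    linarith

theorem exists_l1_penalized_minimizer {D : Set (EuclideanSpace ℝ ι)}
    {L : EuclideanSpace ℝ ι → ℝ} (hL : ConvexOn ℝ D L) {θ₀ g : EuclideanSpace ℝ ι}
    {r β lam : ℝ} (hβ : 0 < β) (hball : closedBall θ₀ r ⊆ interior D) (hlam : 0 ≤ lam)
    (hg : ∀ e, 2 * |g e| ≤ lam)
    (hgrowth : ∀ θ ∈ closedBall θ₀ r, β * ‖θ - θ₀‖ ^ 2 ≤ L θ - L θ₀ - ⟪g, θ - θ₀⟫)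
    (hr : 1.5 * lam * √(#{e | θ₀ e ≠ 0} : ℝ) / β < r) :
    ∃ θ ∈ D, IsMinOn (fun θ => L θ + lam * ∑ e, |θ e|) D θ ∧
      ‖θ - θ₀‖ ≤ 1.5 * lam * √(#{e | θ₀ e ≠ 0} : ℝ) / β := by
  set F := fun θ : EuclideanSpace ℝ ι => L θ + lam * ∑ e, |θ e|
  have hF : ConvexOn ℝ D F :=
    hL.add ((convexOn_sum_abs.subset (subset_univ D) hL.1).smul hlam)
  have hθ₀ : θ₀ ∈ closedBall θ₀ r := mem_closedBall_self ((by positivity : (0 : ℝ) ≤ _).trans hr.le)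
  have hsphere : ∀ θ ∈ sphere θ₀ r, F θ₀ < F θ := fun θ hθ => by
    by_contra! hle
    have := norm_sub_le_of_l1_penalized_le hβ hlam hg (hgrowth θ (sphere_subset_closedBall hθ)) hle
    rw [mem_sphere_iff_norm.1 hθ] at this
    linarith
  obtain ⟨θ, hθ, hloc⟩ := exists_isLocalMin_mem_ball
    (hF.continuousOn_interior.mono hball) hθ₀ hsphere
  have hθr := ball_subset_closedBall hθ
  have hmin : IsMinOn F D θ :=
    .of_isLocalMinOn_of_convexOn (interior_subset (hball hθr)) (hloc.on D) hF
  exact ⟨θ, interior_subset (hball hθr), hmin, norm_sub_le_of_l1_penalized_le hβ hlam hg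
    (hgrowth θ hθr) (hmin (interior_subset (hball hθ₀)))⟩

end Lasso

section Hoelder

variable {α : Type*} [MeasurableSpace α] {μ : Measure α} {u v : α → ℝ} {a b : ℝ}

lemma exp_convexComb_le (ha : 0 ≤ a) (hb : 0 ≤ b) (hab : a + b = 1) (y z : ℝ) :
    Real.exp (a * y + b * z) ≤ a * Real.exp y + b * Real.exp z :=
  convexOn_exp.2 (mem_univ y) (mem_univ z) ha hb hab

lemma integrable_exp_convexComb (hu : Integrable (fun x => Real.exp (u x)) μ)
    (hv : Integrable (fun x => Real.exp (v x)) μ) (ha : 0 ≤ a) (hb : 0 ≤ b) (hab : a + b = 1) :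
    Integrable (fun x => Real.exp (a * u x + b * v x)) μ := by
  have hum := Real.aemeasurable_of_aemeasurable_exp hu.aemeasurable
  have hvm := Real.aemeasurable_of_aemeasurable_exp hv.aemeasurable
  refine ((hu.const_mul a).add (hv.const_mul b)).mono'
    ((hum.const_mul a).add (hvm.const_mul b)).exp.aestronglyMeasurable (.of_forall fun x => ?_)
  rw [Real.norm_eq_abs, Real.abs_exp]
  exact exp_convexComb_le ha hb hab _ _

lemma integral_exp_convexComb_lt_one (hu : Integrable (fun x => Real.exp (u x)) μ)
    (hv : Integrable (fun x => Real.exp (v x)) μ) (hu1 : ∫ x, Real.exp (u x) ∂μ = 1)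
    (hv1 : ∫ x, Real.exp (v x) ∂μ = 1) (ha : 0 < a) (hb : 0 < b) (hab : a + b = 1)
    (hne : ¬ u =ᵐ[μ] v) : ∫ x, Real.exp (a * u x + b * v x) ∂μ < 1 := by
  have hw := integrable_exp_convexComb hu hv ha.le hb.le hab
  have hmaj := (hu.const_mul a).add (hv.const_mul b)
  have hle := fun x => exp_convexComb_le ha.le hb.le hab (u x) (v x)
  have htotal : ∫ x, (a * Real.exp (u x) + b * Real.exp (v x)) ∂μ = 1 := by
    rw [integral_add (hu.const_mul a) (hv.const_mul b), integral_const_mul, integral_const_mul,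
      hu1, hv1, mul_one, mul_one, hab]
  rw [← htotal]
  refine (integral_mono hw hmaj hle).lt_of_ne fun heq => hne ?_
  filter_upwards [(integral_eq_iff_of_ae_le hw hmaj (.of_forall hle)).1 heq] with x hx
  by_contra hxne
  exact (strictConvexOn_exp.2 (mem_univ _) (mem_univ _) hxne ha hb hab).ne hx

theorem log_integral_exp_convexComb_lt (hu : Integrable (fun x => Real.exp (u x)) μ)
    (hv : Integrable (fun x => Real.exp (v x)) μ) (ha : 0 < a) (hb : 0 < b) (hab : a + b = 1)
    (hne : ∀ c, ¬ ∀ᵐ x ∂μ, u x - v x = c) :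
    Real.log (∫ x, Real.exp (a * u x + b * v x) ∂μ) <
      a * Real.log (∫ x, Real.exp (u x) ∂μ) + b * Real.log (∫ x, Real.exp (v x) ∂μ) := by
  have : NeZero μ := ⟨by rintro rfl; exact hne 0 (by simp)⟩
  set A := Real.log (∫ x, Real.exp (u x) ∂μ)
  set B := Real.log (∫ x, Real.exp (v x) ∂μ)
  have hshift (w : α → ℝ) (c : ℝ) (x : α) :
      Real.exp (w x - c) = Real.exp (w x) / Real.exp c := Real.exp_sub _ _
  have hnorm {w : α → ℝ} (hw : Integrable (fun x => Real.exp (w x)) μ) :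
      ∫ x, Real.exp (w x - Real.log (∫ x, Real.exp (w x) ∂μ)) ∂μ = 1 := by
    simp only [hshift, integral_div, Real.exp_log (integral_exp_pos hw)]
    exact div_self (integral_exp_pos hw).ne'
  have hlt := integral_exp_convexComb_lt_one (u := fun x => u x - A) (v := fun x => v x - B)
    (by simpa only [hshift] using hu.div_const (Real.exp A))
    (by simpa only [hshift] using hv.div_const (Real.exp B)) (hnorm hu) (hnorm hv) ha hb hab
    fun h => hne (A - B) (h.mono fun x hx => by linarith)
  have hcomb (x : α) : Real.exp (a * (u x - A) + b * (v x - B)) =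
      Real.exp (a * u x + b * v x) / Real.exp (a * A + b * B) := by
    rw [← Real.exp_sub]
    ring_nf
  simp only [hcomb, integral_div] at hlt
  rw [div_lt_one (Real.exp_pos _)] at hlt
  exact (Real.log_lt_iff_lt_exp
    (integral_exp_pos (integrable_exp_convexComb hu hv ha.le hb.le hab))).2 hlt

end Hoelder

section QuadraticGrowth

lemma one_add_add_min_sq_le_exp (y : ℝ) : 1 + y + min (y ^ 2) 1 / 4 ≤ Real.exp y := by
  rcases le_total y (-1) with hy | hy
  · have hexp : Real.exp (-1) * (y + 1 + 1) ≤ Real.exp y := by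
      rw [show y = -1 + (y + 1) by ring, Real.exp_add]
      gcongr
      simpa using Real.add_one_le_exp (y + 1)
    have hlo : 1 / 4 ≤ Real.exp (-1) := by linarith [Real.exp_neg_one_gt_d9]
    have hhi : Real.exp (-1) ≤ 1 := Real.exp_le_one_iff.2 (by norm_num)
    nlinarith [min_le_right (y ^ 2) 1]
  rcases le_total y 1 with hy' | hy'
  · have hbound : |Real.exp y - (1 + y + y ^ 2 / 2)| ≤ |y| ^ 3 * (2 / 9) := by
      have h := Real.exp_bound (abs_le.2 ⟨hy, hy'⟩) (n := 3) (by norm_num)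
      norm_num [Finset.sum_range_succ, Nat.factorial] at h
      exact h
    have hcube : |y| ^ 3 ≤ y ^ 2 := by
      rw [pow_succ, sq_abs]
      exact mul_le_of_le_one_right (sq_nonneg y) (abs_le.2 ⟨hy, hy'⟩)
    nlinarith [(abs_le.1 hbound).1, min_le_left (y ^ 2) 1]
  · nlinarith [Real.quadratic_le_exp_of_nonneg (zero_le_one.trans hy'), min_le_left (y ^ 2) 1]

lemma min_sq_one_nonneg (y : ℝ) : 0 ≤ min (y ^ 2) 1 := le_min (sq_nonneg y) zero_le_one

lemma norm_min_sq_one_le (y : ℝ) : ‖min (y ^ 2) 1‖ ≤ 1 := by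
  rw [Real.norm_of_nonneg (min_sq_one_nonneg y)]
  exact min_le_right _ _

lemma sq_mul_min_sq_one_le {t : ℝ} (ht : t ^ 2 ≤ 1) (y : ℝ) :
    t ^ 2 * min (y ^ 2) 1 ≤ min ((t * y) ^ 2) 1 := by
  refine le_min ?_ (mul_le_one₀ ht (min_sq_one_nonneg y) (min_le_right _ _))
  rw [mul_pow]
  gcongr
  exact min_le_left _ _

lemma div_eight_le_log_one_add_div_four {m : ℝ} (h0 : 0 ≤ m) (h1 : m ≤ 1) :
    m / 8 ≤ Real.log (1 + m / 4) := by
  refine le_trans ?_ (Real.one_sub_inv_le_log_of_pos (by positivity))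
  rw [le_sub_comm, inv_le_comm₀ (by positivity) (by linarith), ← one_div,
    div_le_iff₀ (by linarith)]
  nlinarith

variable {α E : Type*} [MeasurableSpace α] [NormedAddCommGroup E] [InnerProductSpace ℝ E]
  {Y : α → E} {Q : Measure α}

/-- Linear independence of a vector-valued statistic modulo constants: no nontrivial linear
functional of `Y` is almost everywhere constant. -/
def Nondegenerate (Y : α → E) (Q : Measure α) : Prop :=
  ∀ v ≠ 0, ∀ c : ℝ, ¬ ∀ᵐ x ∂Q, ⟪v, Y x⟫ = c

/-- The second moment of `⟪v, Y⟫`, truncated so that it is finite and continuous in `v` without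
any integrability assumption. -/
noncomputable def truncatedSecondMoment (Y : α → E) (Q : Measure α) (v : E) : ℝ :=
  ∫ x, min (⟪v, Y x⟫ ^ 2) 1 ∂Q

lemma Nondegenerate.sub_const (h : Nondegenerate Y Q) (m : E) :
    Nondegenerate (fun x => Y x - m) Q := fun v hv c hc =>
  h v hv (c + ⟪v, m⟫) <| hc.mono fun x hx => by rw [← hx, inner_sub_right, sub_add_cancel]

lemma aestronglyMeasurable_min_inner_sq (hY : AEStronglyMeasurable Y Q) (v : E) :
    AEStronglyMeasurable (fun x => min (⟪v, Y x⟫ ^ 2) 1) Q :=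
  ((hY.const_inner (𝕜 := ℝ) (c := v)).pow 2).inf aestronglyMeasurable_const

lemma truncatedSecondMoment_nonneg (v : E) : 0 ≤ truncatedSecondMoment Y Q v :=
  integral_nonneg fun _ => min_sq_one_nonneg _

section FiniteMeasure

variable [IsFiniteMeasure Q]

lemma integrable_min_inner_sq (hY : AEStronglyMeasurable Y Q) (v : E) :
    Integrable (fun x => min (⟪v, Y x⟫ ^ 2) 1) Q :=
  .of_bound (aestronglyMeasurable_min_inner_sq hY v) 1 (.of_forall fun _ => norm_min_sq_one_le _)

lemma continuous_truncatedSecondMoment (hY : AEStronglyMeasurable Y Q) :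
    Continuous (truncatedSecondMoment Y Q) :=
  continuous_of_dominated (aestronglyMeasurable_min_inner_sq hY)
    (fun _ => .of_forall fun _ => norm_min_sq_one_le _) (integrable_const 1)
    (.of_forall fun _ => by fun_prop)

lemma Nondegenerate.truncatedSecondMoment_pos (hY : AEStronglyMeasurable Y Q)
    (hnd : Nondegenerate Y Q) {v : E} (hv : v ≠ 0) : 0 < truncatedSecondMoment Y Q v := by
  refine (truncatedSecondMoment_nonneg v).lt_of_ne' fun h0 => hnd v hv 0 ?_
  filter_upwards [(integral_eq_zero_iff_of_nonneg (fun _ => min_sq_one_nonneg _)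
    (integrable_min_inner_sq hY v)).1 h0] with x hx
  by_contra hne
  exact (lt_min (by positivity) one_pos : 0 < min (⟪v, Y x⟫ ^ 2) 1).ne' hx

lemma sq_mul_truncatedSecondMoment_le (hY : AEStronglyMeasurable Y Q) {t : ℝ} (ht : t ^ 2 ≤ 1)
    (v : E) : t ^ 2 * truncatedSecondMoment Y Q v ≤ truncatedSecondMoment Y Q (t • v) := by
  rw [truncatedSecondMoment, truncatedSecondMoment, ← integral_const_mul]
  refine integral_mono ((integrable_min_inner_sq hY v).const_mul _)
    (integrable_min_inner_sq hY _) fun x => ?_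
  simpa only [real_inner_smul_left] using sq_mul_min_sq_one_le ht ⟪v, Y x⟫

lemma exists_mul_sq_norm_le_truncatedSecondMoment [FiniteDimensional ℝ E]
    (hY : AEStronglyMeasurable Y Q) (hnd : Nondegenerate Y Q) :
    ∃ δ > 0, ∀ v : E, ‖v‖ ≤ 1 → δ * ‖v‖ ^ 2 ≤ truncatedSecondMoment Y Q v := by
  rcases subsingleton_or_nontrivial E with _ | _
  · exact ⟨1, one_pos, fun v _ => by
      simpa [Subsingleton.elim v 0] using truncatedSecondMoment_nonneg (0 : E)⟩
  obtain ⟨v₀, hv₀, hmin⟩ := (isCompact_sphere (0 : E) 1).exists_isMinOn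
    (NormedSpace.sphere_nonempty.2 zero_le_one) (continuous_truncatedSecondMoment hY).continuousOn
  refine ⟨truncatedSecondMoment Y Q v₀,
    hnd.truncatedSecondMoment_pos hY (ne_of_mem_sphere hv₀ one_ne_zero), fun v hv => ?_⟩
  rcases eq_or_ne v 0 with rfl | hv0
  · simpa using truncatedSecondMoment_nonneg (0 : E)
  have hunit : ‖v‖⁻¹ • v ∈ sphere (0 : E) 1 := by simp [norm_smul, hv0]
  calc truncatedSecondMoment Y Q v₀ * ‖v‖ ^ 2
      ≤ ‖v‖ ^ 2 * truncatedSecondMoment Y Q (‖v‖⁻¹ • v) := by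
        rw [mul_comm]
        gcongr
        exact hmin hunit
    _ ≤ truncatedSecondMoment Y Q (‖v‖ • ‖v‖⁻¹ • v) :=
        sq_mul_truncatedSecondMoment_le hY (pow_le_one₀ (norm_nonneg v) hv) _
    _ = truncatedSecondMoment Y Q v := by rw [smul_inv_smul₀ (norm_ne_zero_iff.2 hv0)]

end FiniteMeasure

variable [IsProbabilityMeasure Q]

lemma truncatedSecondMoment_le_one (hY : AEStronglyMeasurable Y Q) (v : E) :
    truncatedSecondMoment Y Q v ≤ 1 := by
  simpa [truncatedSecondMoment] using integral_mono (integrable_min_inner_sq hY v)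
    (integrable_const 1) fun _ => min_le_right _ _

lemma truncatedSecondMoment_div_eight_le_log_integral_exp [CompleteSpace E] {v : E}
    (hY : Integrable Y Q) (hY0 : ∫ x, Y x ∂Q = 0)
    (hexp : Integrable (fun x => Real.exp ⟪v, Y x⟫) Q) :
    truncatedSecondMoment Y Q v / 8 ≤ Real.log (∫ x, Real.exp ⟪v, Y x⟫ ∂Q) := by
  have hM0 : 0 ≤ truncatedSecondMoment Y Q v := truncatedSecondMoment_nonneg v
  have hM := integrable_min_inner_sq hY.1 v
  have hlin : Integrable (fun x => 1 + ⟪v, Y x⟫) Q := (integrable_const 1).add (hY.const_inner v)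
  refine (div_eight_le_log_one_add_div_four hM0 (truncatedSecondMoment_le_one hY.1 v)).trans
    (Real.log_le_log (by positivity) ?_)
  calc 1 + truncatedSecondMoment Y Q v / 4
      = ∫ x, (1 + ⟪v, Y x⟫ + min (⟪v, Y x⟫ ^ 2) 1 / 4) ∂Q := by
        rw [integral_add hlin (hM.div_const 4),
          integral_add (integrable_const 1) (hY.const_inner v), integral_inner hY, hY0,
          integral_div]
        simp [truncatedSecondMoment]
    _ ≤ ∫ x, Real.exp ⟪v, Y x⟫ ∂Q :=
        integral_mono (hlin.add (hM.div_const 4)) hexp fun _ => one_add_add_min_sq_le_exp _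

theorem Nondegenerate.exists_quadratic_growth_log_integral_exp [FiniteDimensional ℝ E]
    (hnd : Nondegenerate Y Q) (hY : Integrable Y Q) :
    ∃ β > 0, ∀ v : E, ‖v‖ ≤ 1 → Integrable (fun x => Real.exp ⟪v, Y x⟫) Q →
      β * ‖v‖ ^ 2 ≤ Real.log (∫ x, Real.exp ⟪v, Y x⟫ ∂Q) - ⟪v, ∫ x, Y x ∂Q⟫ := by
  have := FiniteDimensional.complete ℝ E
  set m := ∫ x, Y x ∂Q with hm
  have hYm : Integrable (fun x => Y x - m) Q := hY.sub (integrable_const m)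
  have hYm0 : ∫ x, (Y x - m) ∂Q = 0 := by
    rw [integral_sub hY (integrable_const m), ← hm]
    simp
  obtain ⟨δ, hδ, hlower⟩ :=
    exists_mul_sq_norm_le_truncatedSecondMoment hYm.1 (hnd.sub_const m)
  refine ⟨δ / 8, by positivity, fun v hv hexp => ?_⟩
  have hcentre (x : α) :
      Real.exp ⟪v, Y x - m⟫ = Real.exp ⟪v, Y x⟫ / Real.exp ⟪v, m⟫ := by
    rw [inner_sub_right, Real.exp_sub]
  have hgrowth := truncatedSecondMoment_div_eight_le_log_integral_exp (v := v) hYm hYm0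
    (by simpa only [hcentre] using hexp.div_const (Real.exp ⟪v, m⟫))
  simp only [hcentre, integral_div] at hgrowth
  rw [Real.log_div (integral_exp_pos hexp).ne' (Real.exp_pos _).ne', Real.log_exp] at hgrowth
  linarith [hlower v hv]

end QuadraticGrowth

section Subexponential

variable {Ω : Type*} [MeasurableSpace Ω] {μ : Measure Ω} {X : Ω → ℝ} {v ζ : ℝ}

/-- Sub-exponential random variables with variance proxy `v` and range `ζ`: for `|t| ≤ ζ` the
cumulant generating function of `X - μ[X]` is at most that of a Gaussian of variance `v`. -/
structure IsSubexponential (X : Ω → ℝ) (v ζ : ℝ) (μ : Measure Ω) : Prop where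
  integrable_exp_mul : ∀ t, |t| ≤ ζ → Integrable (fun ω => Real.exp (t * X ω)) μ
  cgf_le : ∀ t, |t| ≤ ζ → cgf X μ t ≤ t * μ[X] + v * t ^ 2 / 2

lemma hasDerivAt_cgf_zero [IsProbabilityMeasure μ]
    (h : 0 ∈ interior (integrableExpSet X μ)) : HasDerivAt (cgf X μ) μ[X] 0 := by
  simpa [deriv_cgf_zero h] using (analyticAt_cgf h).differentiableAt.hasDerivAt

lemma cgf_sub_mul_integral_isBigO [IsProbabilityMeasure μ]
    (h : 0 ∈ interior (integrableExpSet X μ)) :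
    (fun t => cgf X μ t - t * μ[X]) =O[𝓝 0] fun t => t ^ 2 := by
  obtain ⟨q, hq⟩ := analyticAt_cgf h
  have hq0 : q.coeff 0 = 0 := by simpa using hq.coeff_zero fun _ => 1
  have hq1 : q.coeff 1 = μ[X] := hq.deriv.symm.trans (hasDerivAt_cgf_zero h).deriv
  refine (hq.isBigO_sub_partialSum_pow 2).congr (fun t => ?_) fun t => by simp
  simp [FormalMultilinearSeries.partialSum, Finset.sum_range_succ, hq0, hq1]

theorem eventually_isSubexponential [IsProbabilityMeasure μ]
    (h : 0 ∈ interior (integrableExpSet X μ)) :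
    ∀ᶠ v in atTop, ∀ᶠ ζ in 𝓝[>] 0, IsSubexponential X v ζ μ := by
  obtain ⟨C, hC⟩ := (cgf_sub_mul_integral_isBigO h).bound
  filter_upwards [eventually_ge_atTop (2 * C)] with v hv
  obtain ⟨ε, hε, hball⟩ := nhds_basis_closedBall.mem_iff.1
    (hC.and (mem_interior_iff_mem_nhds.1 h))
  filter_upwards [Ioc_mem_nhdsGT hε] with ζ hζ
  have hmem (t : ℝ) (ht : |t| ≤ ζ) : t ∈ closedBall (0 : ℝ) ε := by
    simpa using ht.trans hζ.2
  refine ⟨fun t ht => (hball (hmem t ht)).2, fun t ht => ?_⟩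
  have hle := (le_abs_self _).trans (hball (hmem t ht)).1
  rw [Real.norm_of_nonneg (sq_nonneg t)] at hle
  nlinarith [sq_nonneg t]

theorem exists_forall_isSubexponential [IsProbabilityMeasure μ] {ι : Type*} [Finite ι]
    {X : ι → Ω → ℝ} (h : ∀ i, 0 ∈ interior (integrableExpSet (X i) μ)) :
    ∃ σ > 0, ∃ ζ > 0, ∀ i, IsSubexponential (X i) (σ ^ 2) ζ μ := by
  obtain ⟨v, hX, hv⟩ := ((eventually_all.2 fun i => eventually_isSubexponential (h i)).and
    (eventually_gt_atTop 0)).exists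
  obtain ⟨ζ, hXζ, hζ⟩ := ((eventually_all.2 hX).and self_mem_nhdsWithin).exists
  exact ⟨√v, Real.sqrt_pos.2 hv, ζ, hζ, fun i => by rw [Real.sq_sqrt hv.le]; exact hXζ i⟩

lemma IsSubexponential.neg (hX : IsSubexponential X v ζ μ) : IsSubexponential (-X) v ζ μ where
  integrable_exp_mul t ht := by
    simpa using hX.integrable_exp_mul (-t) (by rwa [abs_neg])
  cgf_le t ht := by
    simpa [cgf_neg, integral_neg] using hX.cgf_le (-t) (by rwa [abs_neg])

lemma IsSubexponential.zero_mem_interior_integrableExpSet (hX : IsSubexponential X v ζ μ)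
    (hζ : 0 < ζ) : 0 ∈ interior (integrableExpSet X μ) :=
  mem_interior_iff_mem_nhds.2 <| mem_of_superset (closedBall_mem_nhds 0 hζ) fun t ht =>
    hX.integrable_exp_mul t (by simpa using ht)

lemma IsSubexponential.comp_hasLaw {α : Type*} [MeasurableSpace α] {Q : Measure α} {Y : α → ℝ}
    (hY : IsSubexponential Y v ζ Q) (hζ : 0 < ζ) {Z : Ω → α} (hZ : HasLaw Z Q μ) :
    IsSubexponential (Y ∘ Z) v ζ μ where
  integrable_exp_mul t ht := by
    have := hY.integrable_exp_mul t ht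
    rw [← hZ.map_eq] at this
    exact this.comp_aemeasurable hZ.aemeasurable
  cgf_le t ht := by
    have hint := hY.integrable_exp_mul t ht
    have hmeas := (integrable_of_mem_interior_integrableExpSet
      (hY.zero_mem_interior_integrableExpSet hζ)).1
    rw [cgf, ← mgf_map hZ.aemeasurable (by rw [hZ.map_eq]; exact hint.1), hZ.map_eq,
      hZ.integral_comp hmeas]
    exact hY.cgf_le t ht

lemma IsSubexponential.sum {ι : Type*} [Fintype ι] {X : ι → Ω → ℝ} {v : ι → ℝ} (hζ : 0 < ζ)
    (hX : ∀ i, IsSubexponential (X i) (v i) ζ μ) (hind : iIndepFun X μ) :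
    IsSubexponential (∑ i, X i) (∑ i, v i) ζ μ := by
  have := hind.isProbabilityMeasure
  have hint (i : ι) : Integrable (X i) μ := integrable_of_mem_interior_integrableExpSet
    ((hX i).zero_mem_interior_integrableExpSet hζ)
  have hmeas (i : ι) : AEMeasurable (X i) μ := (hint i).aemeasurable
  refine ⟨fun t ht => ?_, fun t ht => ?_⟩
  · rw [← mgf_pos_iff, hind.mgf_sum₀ hmeas]
    exact Finset.prod_pos fun i _ => mgf_pos ((hX i).integrable_exp_mul t ht)
  · rw [hind.cgf_sum₀ hmeas fun i _ => (hX i).integrable_exp_mul t ht]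
    simp only [Finset.sum_apply]
    rw [integral_finsetSum _ fun i _ => hint i, Finset.mul_sum, Finset.sum_mul, Finset.sum_div,
      ← Finset.sum_add_distrib]
    exact Finset.sum_le_sum fun i _ => (hX i).cgf_le t ht

section Tail

variable [IsFiniteMeasure μ]

lemma IsSubexponential.measure_sub_integral_ge_le (hX : IsSubexponential X v ζ μ) (hv : 0 < v)
    {s : ℝ} (hs : 0 ≤ s) (hsζ : s ≤ v * ζ) :
    μ.real {ω | s ≤ X ω - μ[X]} ≤ Real.exp (-(s ^ 2 / (2 * v))) := by
  have ht : |s / v| ≤ ζ := by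
    rw [abs_of_nonneg (by positivity)]
    exact (div_le_iff₀' hv).2 hsζ
  simp only [le_sub_iff_add_le]
  refine (measure_ge_le_exp_cgf (s + μ[X]) (by positivity : 0 ≤ s / v)
    (hX.integrable_exp_mul _ ht)).trans (Real.exp_le_exp.2 ?_)
  calc -(s / v) * (s + μ[X]) + cgf X μ (s / v)
      ≤ -(s / v) * (s + μ[X]) + (s / v * μ[X] + v * (s / v) ^ 2 / 2) := by
        gcongr
        exact hX.cgf_le _ ht
    _ = -(s ^ 2 / (2 * v)) := by
        field_simp
        ring

lemma IsSubexponential.measure_abs_sub_integral_ge_le (hX : IsSubexponential X v ζ μ)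
    (hv : 0 < v) {s : ℝ} (hs : 0 ≤ s) (hsζ : s ≤ v * ζ) :
    μ.real {ω | s ≤ |X ω - μ[X]|} ≤ 2 * Real.exp (-(s ^ 2 / (2 * v))) := by
  have hunion : {ω | s ≤ |X ω - μ[X]|} =
      {ω | s ≤ X ω - μ[X]} ∪ {ω | s ≤ (-X) ω - μ[-X]} := by
    ext ω
    simp [le_abs, integral_neg, neg_add_eq_sub]
  rw [hunion, two_mul]
  exact (measureReal_union_le _ _).trans (add_le_add (hX.measure_sub_integral_ge_le hv hs hsζ)
    (hX.neg.measure_sub_integral_ge_le hv hs hsζ))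

end Tail

section Sample

variable {α : Type*} [MeasurableSpace α] {Q : Measure α} {Y : α → ℝ} {n : ℕ} {Z : Fin n → Ω → α}

lemma IsSubexponential.sum_sample (hY : IsSubexponential Y v ζ Q) (hζ : 0 < ζ)
    (hZ : ∀ i, HasLaw (Z i) Q μ) (hind : iIndepFun Z μ) :
    IsSubexponential (fun ω => ∑ i, Y (Z i ω)) (n * v) ζ μ := by
  have hYm := integrable_of_mem_interior_integrableExpSet
    (hY.zero_mem_interior_integrableExpSet hζ)
  have hindY : iIndepFun (fun i => Y ∘ Z i) μ := hind.comp₀ _ (fun i => (hZ i).aemeasurable)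
    fun i => by rw [(hZ i).map_eq]; exact hYm.aemeasurable
  simpa [Finset.sum_fn] using IsSubexponential.sum hζ (fun i => hY.comp_hasLaw hζ (hZ i)) hindY

lemma IsSubexponential.integral_sum_sample (hY : IsSubexponential Y v ζ Q) (hζ : 0 < ζ)
    (hZ : ∀ i, HasLaw (Z i) Q μ) : ∫ ω, ∑ i, Y (Z i ω) ∂μ = n * ∫ y, Y y ∂Q := by
  have hYm := integrable_of_mem_interior_integrableExpSet
    (hY.zero_mem_interior_integrableExpSet hζ)
  have hmean (i : Fin n) : ∫ ω, Y (Z i ω) ∂μ = ∫ y, Y y ∂Q := (hZ i).integral_comp hYm.1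
  have hint (i : Fin n) : Integrable (fun ω => Y (Z i ω)) μ :=
    integrable_of_mem_interior_integrableExpSet
      ((hY.comp_hasLaw hζ (hZ i)).zero_mem_interior_integrableExpSet hζ)
  simp [integral_finsetSum _ fun i _ => hint i, hmean]

theorem IsSubexponential.measure_abs_integral_sub_sampleMean_ge_le (hY : IsSubexponential Y v ζ Q)
    (hv : 0 < v) (hζ : 0 < ζ) (hZ : ∀ i, HasLaw (Z i) Q μ) (hind : iIndepFun Z μ) (hn : 0 < n)
    {s : ℝ} (hs : 0 ≤ s) (hsζ : s ≤ v * ζ) :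
    μ.real {ω | s ≤ |∫ y, Y y ∂Q - (1 / (n : ℝ)) * ∑ i, Y (Z i ω)|} ≤
      2 * Real.exp (-(n * s ^ 2 / (2 * v))) := by
  have hn' : (0 : ℝ) < n := Nat.cast_pos.2 hn
  have := hind.isProbabilityMeasure
  have hscale (ω : Ω) : n * s ≤ |∑ i, Y (Z i ω) - n * ∫ y, Y y ∂Q| ↔
      s ≤ |∫ y, Y y ∂Q - (1 / (n : ℝ)) * ∑ i, Y (Z i ω)| := by
    have hmul : n * (∫ y, Y y ∂Q - (1 / (n : ℝ)) * ∑ i, Y (Z i ω)) =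
        n * ∫ y, Y y ∂Q - ∑ i, Y (Z i ω) := by field_simp
    rw [abs_sub_comm, ← hmul, abs_mul, abs_of_pos hn', mul_le_mul_iff_right₀ hn']
  have htail := (hY.sum_sample hζ hZ hind).measure_abs_sub_integral_ge_le (by positivity)
    (by positivity : 0 ≤ n * s) (by rw [mul_assoc]; gcongr)
  simp only [hY.integral_sum_sample hζ hZ, hscale] at htail
  rwa [show (n * s) ^ 2 / (2 * (n * v)) = n * s ^ 2 / (2 * v) by field_simp] at htail

end Sample

end Subexponential

section Model

variable {𝒳 : Type*} {p : ℕ} {φ : 𝒳 → 𝒳 → ℝ}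

/-- The sufficient statistic `(φ(x_s, x_t))_{s < t}` of the model, as a vector of the parameter
space, so that the interaction part of the energy is the inner product `⟪θ, suffStat φ x⟫`. -/
noncomputable def suffStat (φ : 𝒳 → 𝒳 → ℝ) (x : Fin p → 𝒳) : Param p :=
  WithLp.toLp 2 fun e => φ (x e.1.1) (x e.1.2)

lemma energy_eq (f : 𝒳 → ℝ) (θ : Param p) (x : Fin p → 𝒳) :
    energy f φ θ x = ∑ s, f (x s) + ⟪θ, suffStat φ x⟫ := by
  simp [energy, suffStat, PiLp.inner_apply, mul_comm]

lemma energy_add (f : 𝒳 → ℝ) (θ v : Param p) (x : Fin p → 𝒳) :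
    energy f φ (θ + v) x = energy f φ θ x + ⟪v, suffStat φ x⟫ := by
  rw [energy_eq, energy_eq, inner_add_left, add_assoc]

lemma energy_sub_energy (f : 𝒳 → ℝ) (θ₁ θ₂ : Param p) (x : Fin p → 𝒳) :
    energy f φ θ₁ x - energy f φ θ₂ x = ⟪θ₁ - θ₂, suffStat φ x⟫ := by
  rw [energy_eq, energy_eq, inner_sub_left, add_sub_add_left_eq_sub]

lemma energy_convexComb (f : 𝒳 → ℝ) (θ₁ θ₂ : Param p) {a b : ℝ} (hab : a + b = 1)
    (x : Fin p → 𝒳) :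
    energy f φ (a • θ₁ + b • θ₂) x = a * energy f φ θ₁ x + b * energy f φ θ₂ x := by
  simp only [energy_eq, inner_add_left, real_inner_smul_left]
  linear_combination -(∑ s, f (x s)) * hab

section WeightedDegree

variable {f : 𝒳 → ℝ} {θ : Param p}

lemma IsMercerKernel.abs_apply_le (hφ : IsMercerKernel φ) (y z : 𝒳) :
    |φ y z| ≤ (φ y y + φ z z) / 2 := by
  have h := hφ 2 ![y, z]
  have hsymm : φ z y = φ y z := by simpa using h.isHermitian.apply 0 1
  have hquad (a b : ℝ) : 0 ≤ a ^ 2 * φ y y + 2 * a * b * φ y z + b ^ 2 * φ z z :=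
    (h.dotProduct_mulVec_nonneg ![a, b]).trans_eq <| by
      simp [dotProduct, Matrix.mulVec, Fin.sum_univ_two, hsymm]
      ring
  exact abs_le.2 ⟨by linarith [hquad 1 1], by linarith [hquad 1 (-1)]⟩

/-- The weighted degree of the vertex `s`: the sum of the weights `|θ_e|` of the edges at `s`. -/
noncomputable def weightedDegree (θ : Param p) (s : Fin p) : ℝ :=
  ∑ e : Pairs p with e.1.1 = s ∨ e.1.2 = s, |θ e|

lemma sum_weightedDegree_mul (θ : Param p) (d : Fin p → ℝ) :
    ∑ s, weightedDegree θ s * d s = ∑ e : Pairs p, |θ e| * (d e.1.1 + d e.1.2) := by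
  simp only [weightedDegree, Finset.sum_mul]
  rw [Finset.sum_comm' (t' := Finset.univ) (s' := fun e : Pairs p => {e.1.1, e.1.2})
    (by simp [eq_comm])]
  exact Finset.sum_congr rfl fun e _ => by rw [Finset.sum_pair e.2.ne, mul_add]

lemma weightedDegree_le_degree_mul {b : ℝ} (hb : ∀ e, |θ e| ≤ b) (s : Fin p) :
    weightedDegree θ s ≤ degree θ s * b := by
  calc weightedDegree θ s = ∑ e : Pairs p with θ e ≠ 0 ∧ (e.1.1 = s ∨ e.1.2 = s), |θ e| :=
        (Finset.sum_subset (Finset.monotone_filter_right _ fun e _ h => h.2)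
          fun e _ _ => by simp_all).symm
    _ ≤ degree θ s * b :=
        (Finset.sum_le_card_nsmul _ _ b fun e _ => hb e).trans_eq (nsmul_eq_mul _ _)

lemma energy_le_sum_weightedDegree (hφ : IsMercerKernel φ) (hf : ∀ y, f y = -φ y y)
    (x : Fin p → 𝒳) :
    energy f φ θ x ≤ ∑ s, -(1 - weightedDegree θ s / 2) * φ (x s) (x s) := by
  calc energy f φ θ x
      ≤ ∑ s, f (x s) +
          ∑ e : Pairs p, |θ e| * (φ (x e.1.1) (x e.1.1) / 2 + φ (x e.1.2) (x e.1.2) / 2) := by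
        refine add_le_add_right (Finset.sum_le_sum fun e _ => (le_abs_self _).trans ?_) _
        rw [abs_mul, ← add_div]
        gcongr
        exact hφ.abs_apply_le _ _
    _ = ∑ s, -(1 - weightedDegree θ s / 2) * φ (x s) (x s) := by
        rw [← sum_weightedDegree_mul θ fun s => φ (x s) (x s) / 2, ← Finset.sum_add_distrib]
        exact Finset.sum_congr rfl fun s _ => by rw [hf]; ring

end WeightedDegree

variable [MeasurableSpace 𝒳] {ν : Measure 𝒳} {f : 𝒳 → ℝ} {θ : Param p}

lemma convex_domain : Convex ℝ (domain ν f φ : Set (Param p)) := by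
  intro θ₁ h₁ θ₂ h₂ a b ha hb hab
  simpa only [domain, mem_ofPred_eq, energy_convexComb f θ₁ θ₂ hab] using
    integrable_exp_convexComb h₁ h₂ ha hb hab

theorem strictConvexOn_logPartition
    (hnd : Nondegenerate (suffStat φ) (Measure.pi fun _ : Fin p => ν)) :
    StrictConvexOn ℝ (domain ν f φ : Set (Param p)) (logPartition ν f φ) := by
  refine ⟨convex_domain, fun θ₁ h₁ θ₂ h₂ hne a b ha hb hab => ?_⟩
  simp only [logPartition, energy_convexComb f θ₁ θ₂ hab, smul_eq_mul]
  refine log_integral_exp_convexComb_lt h₁ h₂ ha hb hab fun c => ?_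
  simp only [energy_sub_energy]
  exact hnd _ (sub_ne_zero.2 hne) c

/-- If `⟪v, suffStat φ x⟫` were almost everywhere a constant `c`, then `θ + v` would only change the
normalization of the density, by the factor `exp c`. -/
theorem MinimalRepresentation.nondegenerate (hmin : MinimalRepresentation ν f φ θ)
    (hθ : θ ∈ domain ν f φ) : Nondegenerate (suffStat φ) (Measure.pi fun _ : Fin p => ν) := by
  intro v hv c hc
  have hexp : (fun x => Real.exp (energy f φ (θ + v) x)) =ᵐ[Measure.pi fun _ : Fin p => ν]
      fun x => Real.exp c * Real.exp (energy f φ θ x) := hc.mono fun x hx => by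
    simp only [energy_add, hx, Real.exp_add, mul_comm]
  have hmem : θ + v ∈ domain ν f φ := (hθ.const_mul (Real.exp c)).congr hexp.symm
  have hlaw : law ν f φ (θ + v) = law ν f φ θ := by
    rcases eq_zero_or_neZero (Measure.pi fun _ : Fin p => ν) with h0 | _
    · simp [law, h0]
    have hA : logPartition ν f φ (θ + v) = c + logPartition ν f φ θ := by
      rw [logPartition, integral_congr_ae hexp, integral_const_mul,
        Real.log_mul (Real.exp_pos c).ne' (integral_exp_pos hθ).ne', Real.log_exp, logPartition]
    refine withDensity_congr_ae (hc.mono fun x hx => ?_)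
    simp only [density, hA, energy_add, hx, add_comm c, add_sub_add_right_eq_sub]
  exact hv (by simpa using hmin (θ + v) hmem hlaw)

section Law

variable [NeZero (Measure.pi fun _ : Fin p => ν)]

lemma law_eq_tilted (hθ : θ ∈ domain ν f φ) :
    law ν f φ θ = (Measure.pi fun _ : Fin p => ν).tilted (energy f φ θ) := by
  simp only [law, Measure.tilted, density, Real.exp_sub, logPartition,
    Real.exp_log (integral_exp_pos hθ)]

lemma isProbabilityMeasure_law (hθ : θ ∈ domain ν f φ) :
    IsProbabilityMeasure (law ν f φ θ) := by
  rw [law_eq_tilted hθ]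
  exact isProbabilityMeasure_tilted hθ

lemma nondegenerate_law (hθ : θ ∈ domain ν f φ)
    (hnd : Nondegenerate (suffStat φ) (Measure.pi fun _ : Fin p => ν)) :
    Nondegenerate (suffStat φ) (law ν f φ θ) := fun v hv c hc => by
  rw [law_eq_tilted hθ] at hc
  exact hnd v hv c ((absolutelyContinuous_tilted hθ).ae_le hc)

lemma integrable_exp_inner_law_iff (hθ : θ ∈ domain ν f φ) {v : Param p} :
    Integrable (fun x => Real.exp ⟪v, suffStat φ x⟫) (law ν f φ θ) ↔
      θ + v ∈ domain ν f φ := by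
  rw [law_eq_tilted hθ, integrable_tilted_iff hθ]
  simp only [domain, mem_ofPred_eq, energy_add, Real.exp_add, smul_eq_mul]

lemma log_integral_exp_inner_law (hθ : θ ∈ domain ν f φ) {v : Param p}
    (hv : θ + v ∈ domain ν f φ) :
    Real.log (∫ x, Real.exp ⟪v, suffStat φ x⟫ ∂(law ν f φ θ)) =
      logPartition ν f φ (θ + v) - logPartition ν f φ θ := by
  have henergy : energy f φ θ + (fun x => ⟪v, suffStat φ x⟫) = energy f φ (θ + v) :=
    funext fun x => (energy_add f θ v x).symm
  rw [law_eq_tilted hθ, integral_exp_tilted, henergy,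
    Real.log_div (integral_exp_pos hv).ne' (integral_exp_pos hθ).ne', logPartition, logPartition]

lemma zero_mem_interior_integrableExpSet_suffStat (hθ : θ ∈ interior (domain ν f φ))
    (e : Pairs p) :
    0 ∈ interior (integrableExpSet (fun x => suffStat φ x e) (law ν f φ θ)) := by
  have hline : Continuous fun t : ℝ => θ + t • EuclideanSpace.single e (1 : ℝ) := by fun_prop
  refine mem_interior.2 ⟨_, fun t ht => ?_, isOpen_interior.preimage hline, by simpa using hθ⟩
  simpa [integrableExpSet, inner_smul_left, EuclideanSpace.inner_single_left] using
    (integrable_exp_inner_law_iff (interior_subset hθ)).2 (interior_subset ht)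

lemma integrable_suffStat (hθ : θ ∈ interior (domain ν f φ)) :
    Integrable (suffStat φ) (law ν f φ θ) :=
  .of_eval_piLp fun e => integrable_of_mem_interior_integrableExpSet
    (zero_mem_interior_integrableExpSet_suffStat hθ e)

end Law

section Likelihood

variable {n : ℕ} {x : Fin n → Fin p → 𝒳}

lemma negLogLik_eq (hn : 0 < n) (θ : Param p) :
    negLogLik ν f φ x θ =
      logPartition ν f φ θ - (1 / (n : ℝ)) * ∑ i, energy f φ θ (x i) := by
  simp only [negLogLik, density, Real.log_exp, Finset.sum_sub_distrib, Finset.sum_const,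
    Finset.card_univ, Fintype.card_fin, nsmul_eq_mul]
  field_simp
  ring

theorem strictConvexOn_negLogLik (hn : 0 < n)
    (hnd : Nondegenerate (suffStat φ) (Measure.pi fun _ : Fin p => ν)) :
    StrictConvexOn ℝ (domain ν f φ) (negLogLik ν f φ x) := by
  have haffine : ConvexOn ℝ (domain ν f φ : Set (Param p))
      fun θ => -((1 / (n : ℝ)) * ∑ i, energy f φ θ (x i)) := by
    refine ⟨convex_domain, fun θ₁ _ θ₂ _ a b _ _ hab => le_of_eq ?_⟩
    simp only [energy_convexComb f θ₁ θ₂ hab, Finset.sum_add_distrib, ← Finset.mul_sum,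
      smul_eq_mul]
    ring
  exact ((strictConvexOn_logPartition hnd).add_convexOn haffine).congr fun θ _ => by
    rw [negLogLik_eq hn, sub_eq_add_neg]; rfl

/-- The gradient of the negative log-likelihood at an interior point of the domain: the mean of the
sufficient statistic under the model minus its sample mean. -/
noncomputable def score (ν : Measure 𝒳) (f : 𝒳 → ℝ) (φ : 𝒳 → 𝒳 → ℝ) (x : Fin n → Fin p → 𝒳)
    (θ : Param p) : Param p :=
  ∫ y, suffStat φ y ∂(law ν f φ θ) - (1 / (n : ℝ)) • ∑ i, suffStat φ (x i)

variable [NeZero (Measure.pi fun _ : Fin p => ν)]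

lemma negLogLik_add (hn : 0 < n) (hθ : θ ∈ domain ν f φ) {v : Param p}
    (hv : θ + v ∈ domain ν f φ) :
    negLogLik ν f φ x (θ + v) = negLogLik ν f φ x θ +
      (Real.log (∫ y, Real.exp ⟪v, suffStat φ y⟫ ∂(law ν f φ θ)) -
        ⟪v, (1 / (n : ℝ)) • ∑ i, suffStat φ (x i)⟫) := by
  rw [log_integral_exp_inner_law hθ hv, negLogLik_eq hn, negLogLik_eq hn, real_inner_smul_right,
    inner_sum]
  simp only [energy_add, Finset.sum_add_distrib]
  ring

lemma score_apply (hθ : θ ∈ interior (domain ν f φ)) (e : Pairs p) :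
    score ν f φ x θ e = ∫ y, suffStat φ y e ∂(law ν f φ θ) -
      (1 / (n : ℝ)) * ∑ i, suffStat φ (x i) e := by
  simp [score, eval_integral_piLp (integrable_suffStat hθ).eval_piLp]

theorem lineDeriv_negLogLik (hn : 0 < n) (hθ : θ ∈ interior (domain ν f φ)) (e : Pairs p) :
    lineDeriv ℝ (negLogLik ν f φ x) θ (EuclideanSpace.single e 1) = score ν f φ x θ e := by
  have hθD := interior_subset hθ
  have := isProbabilityMeasure_law hθD
  have hline : Continuous fun t : ℝ => θ + t • EuclideanSpace.single e (1 : ℝ) := by fun_prop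
  have hnear : (fun t : ℝ => negLogLik ν f φ x (θ + t • EuclideanSpace.single e 1)) =ᶠ[𝓝 0]
      fun t => negLogLik ν f φ x θ +
        (cgf (fun y => suffStat φ y e) (law ν f φ θ) t -
          t * ((1 / (n : ℝ)) * ∑ i, suffStat φ (x i) e)) := by
    filter_upwards [(isOpen_interior.preimage hline).mem_nhds (by simpa using hθ)] with t ht
    rw [negLogLik_add hn hθD (interior_subset ht)]
    simp [inner_smul_left, EuclideanSpace.inner_single_left, cgf, mgf]
  have hcgf := hasDerivAt_cgf_zero (zero_mem_interior_integrableExpSet_suffStat hθ e)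
  rw [lineDeriv, hnear.deriv_eq, score_apply hθ]
  exact ((hcgf.sub (hasDerivAt_mul_const _)).const_add _).deriv

lemma gradSupNorm_eq (hn : 0 < n) (hθ : θ ∈ interior (domain ν f φ)) :
    gradSupNorm ν f φ x θ = ⨆ e, |score ν f φ x θ e| := by
  simp only [gradSupNorm, lineDeriv_negLogLik hn hθ]

end Likelihood

section Domain

lemma measurable_energy (hφm : Measurable (Function.uncurry φ)) (hf : ∀ y, f y = -φ y y) :
    Measurable (energy f φ θ) := by
  have hfm : Measurable f := by
    rw [funext hf]
    exact (hφm.comp (measurable_id.prodMk measurable_id)).neg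
  have hpair (e : Pairs p) : Measurable fun x : Fin p → 𝒳 => φ (x e.1.1) (x e.1.2) :=
    hφm.comp (f := fun x : Fin p → 𝒳 => (x e.1.1, x e.1.2)) (by fun_prop)
  exact (Finset.measurable_fun_sum _ fun s _ => hfm.comp (measurable_pi_apply s)).add
    (Finset.measurable_fun_sum _ fun e _ => (hpair e).const_mul (θ e))

lemma mem_domain_of_weightedDegree_lt [SigmaFinite ν] (hφm : Measurable (Function.uncurry φ))
    (hφ : IsMercerKernel φ)
    (hint : ∀ c : ℝ, 0 < c → Integrable (fun y => Real.exp (-c * φ y y)) ν)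
    (hf : ∀ y, f y = -φ y y) (hθ : ∀ s, weightedDegree θ s < 2) : θ ∈ domain ν f φ := by
  have hprod : Integrable (fun x : Fin p → 𝒳 =>
      ∏ s, Real.exp (-(1 - weightedDegree θ s / 2) * φ (x s) (x s)))
      (Measure.pi fun _ : Fin p => ν) :=
    Integrable.fintype_prod_dep (f := fun s y => Real.exp (-(1 - weightedDegree θ s / 2) * φ y y))
      fun s => hint _ (by linarith [hθ s])
  refine hprod.mono' (measurable_energy hφm hf).exp.aestronglyMeasurable (.of_forall fun x => ?_)
  rw [Real.norm_eq_abs, Real.abs_exp, ← Real.exp_sum, Real.exp_le_exp]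
  exact energy_le_sum_weightedDegree hφ hf x

lemma isOpen_setOf_weightedDegree_lt (c : ℝ) :
    IsOpen {θ : Param p | ∀ s, weightedDegree θ s < c} := by
  simp only [ofPred_forall]
  refine isOpen_iInter_of_finite fun s => isOpen_lt ?_ continuous_const
  unfold weightedDegree
  fun_prop

theorem mem_interior_domain_of_degree_lt [SigmaFinite ν] (hφm : Measurable (Function.uncurry φ))
    (hφ : IsMercerKernel φ)
    (hint : ∀ c : ℝ, 0 < c → Integrable (fun y => Real.exp (-c * φ y y)) ν)
    (hf : ∀ y, f y = -φ y y) (hθ : ∀ e, |θ e| ≤ 0.25) (hdeg : ∀ s, degree θ s < 8) :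
    θ ∈ interior (domain ν f φ) := by
  refine mem_interior.2 ⟨_, fun _ => mem_domain_of_weightedDegree_lt hφm hφ hint hf,
    isOpen_setOf_weightedDegree_lt 2, fun s => (weightedDegree_le_degree_mul hθ s).trans_lt ?_⟩
  have : (degree θ s : ℝ) < 8 := by exact_mod_cast hdeg s
  linarith

end Domain

section Estimator

variable {n : ℕ} {x : Fin n → Fin p → 𝒳}

lemma isJointEstimator_iff {lam : ℝ} :
    IsJointEstimator ν f φ x lam θ ↔ θ ∈ domain ν f φ ∧
      IsMinOn (fun θ => negLogLik ν f φ x θ + lam * ∑ e, |θ e|) (domain ν f φ) θ :=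
  Iff.rfl

lemma IsJointEstimator.unique (hn : 0 < n)
    (hnd : Nondegenerate (suffStat φ) (Measure.pi fun _ : Fin p => ν)) {lam : ℝ} (hlam : 0 ≤ lam)
    {θ₁ θ₂ : Param p} (h₁ : IsJointEstimator ν f φ x lam θ₁)
    (h₂ : IsJointEstimator ν f φ x lam θ₂) : θ₁ = θ₂ :=
  ((strictConvexOn_negLogLik hn hnd).add_convexOn
    ((convexOn_sum_abs.subset (subset_univ _) convex_domain).smul hlam)).eq_of_isMinOn
    (isJointEstimator_iff.1 h₁).2 (isJointEstimator_iff.1 h₂).2 h₁.1 h₂.1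

variable [NeZero (Measure.pi fun _ : Fin p => ν)]

theorem MinimalRepresentation.exists_quadratic_growth_negLogLik
    (hmin : MinimalRepresentation ν f φ θ) (hθ : θ ∈ interior (domain ν f φ)) :
    ∃ r > 0, closedBall θ r ⊆ interior (domain ν f φ) ∧ ∃ β > 0,
      ∀ n : ℕ, 0 < n → ∀ x : Fin n → Fin p → 𝒳, ∀ θ' ∈ closedBall θ r,
        β * ‖θ' - θ‖ ^ 2 ≤
          negLogLik ν f φ x θ' - negLogLik ν f φ x θ - ⟪score ν f φ x θ, θ' - θ⟫ := by
  have hθD := interior_subset hθ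
  have := isProbabilityMeasure_law hθD
  obtain ⟨r, hr, hball⟩ := nhds_basis_closedBall.mem_iff.1 (isOpen_interior.mem_nhds hθ)
  obtain ⟨β, hβ, hgrowth⟩ := (nondegenerate_law hθD
    (hmin.nondegenerate hθD)).exists_quadratic_growth_log_integral_exp (integrable_suffStat hθ)
  refine ⟨min r 1, by positivity, (closedBall_subset_closedBall (min_le_left r 1)).trans hball,
    β, hβ, fun n hn x θ' hθ' => ?_⟩
  obtain ⟨hr', h1⟩ := le_min_iff.1 (mem_closedBall_iff_norm.1 hθ')
  have hmem : θ + (θ' - θ) ∈ domain ν f φ := by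
    rw [add_sub_cancel]
    exact interior_subset (hball (mem_closedBall_iff_norm.2 hr'))
  have hlik := negLogLik_add (x := x) hn hθD hmem
  rw [add_sub_cancel] at hlik
  have hinner : ⟪score ν f φ x θ, θ' - θ⟫ = ⟪θ' - θ, ∫ y, suffStat φ y ∂(law ν f φ θ)⟫ -
      ⟪θ' - θ, (1 / (n : ℝ)) • ∑ i, suffStat φ (x i)⟫ := by
    rw [real_inner_comm, score, inner_sub_right]
  linarith [hgrowth _ h1 ((integrable_exp_inner_law_iff hθD).2 hmem)]

lemma abs_score_le_gradSupNorm (hn : 0 < n) (hθ : θ ∈ interior (domain ν f φ)) (e : Pairs p) :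
    |score ν f φ x θ e| ≤ gradSupNorm ν f φ x θ := by
  rw [gradSupNorm_eq hn hθ]
  exact le_ciSup (f := fun e => |score ν f φ x θ e|) (finite_range _).bddAbove e

theorem MinimalRepresentation.exists_jointEstimator_error_le
    (hmin : MinimalRepresentation ν f φ θ) (hθ : θ ∈ interior (domain ν f φ)) :
    ∃ r > 0, ∃ β > 0, ∀ n : ℕ, 0 < n → ∀ (x : Fin n → Fin p → 𝒳) (lam : ℝ),
      2 * gradSupNorm ν f φ x θ ≤ lam → 1.5 * lam * √(l0 θ) / β < r →
      (∃! θhat, IsJointEstimator ν f φ x lam θhat) ∧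
        ∀ θhat, IsJointEstimator ν f φ x lam θhat →
          ‖θhat - θ‖ ≤ 1.5 * lam * √(l0 θ) / β := by
  obtain ⟨r, hr, hball, β, hβ, hgrowth⟩ := hmin.exists_quadratic_growth_negLogLik hθ
  have hnd := hmin.nondegenerate (interior_subset hθ)
  refine ⟨r, hr, β, hβ, fun n hn x lam hgrad hlt => ?_⟩
  have hlam : 0 ≤ lam :=
    (mul_nonneg zero_le_two (Real.iSup_nonneg fun e => abs_nonneg _)).trans hgrad
  have hscore (e : Pairs p) : 2 * |score ν f φ x θ e| ≤ lam :=
    (mul_le_mul_of_nonneg_left (abs_score_le_gradSupNorm hn hθ e) zero_le_two).trans hgrad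
  obtain ⟨θhat, hD, hisMin, herr⟩ := exists_l1_penalized_minimizer
    (strictConvexOn_negLogLik hn hnd).convexOn hβ hball hlam hscore (hgrowth n hn x) hlt
  have hest : IsJointEstimator ν f φ x lam θhat := isJointEstimator_iff.2 ⟨hD, hisMin⟩
  have huniq (θ' : Param p) (h : IsJointEstimator ν f φ x lam θ') : θ' = θhat :=
    h.unique hn hnd hlam hest
  exact ⟨⟨θhat, hest, huniq⟩, fun θ' h => huniq θ' h ▸ herr⟩

end Estimator

end Model

section Event

lemma exists_measurableSet_forall_lt {Ω ι : Type*} [MeasurableSpace Ω] {P : Measure Ω}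
    [IsProbabilityMeasure P] [Fintype ι] {Z : ι → Ω → ℝ} {t δ : ℝ}
    (h : ∀ i, P.real {ω | t ≤ Z i ω} ≤ δ) :
    ∃ G, MeasurableSet G ∧ ENNReal.ofReal (1 - Fintype.card ι * δ) ≤ P G ∧
      ∀ ω ∈ G, ∀ i, Z i ω < t := by
  refine ⟨(toMeasurable P (⋃ i, {ω | t ≤ Z i ω}))ᶜ, (measurableSet_toMeasurable _ _).compl, ?_,
    fun ω hω i => ?_⟩
  · rw [ENNReal.ofReal_le_iff_le_toReal (measure_ne_top _ _), ← Measure.real,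
      probReal_compl_eq_one_sub (measurableSet_toMeasurable _ _), Measure.real,
      measure_toMeasurable, ← Measure.real]
    refine sub_le_sub_left ((measureReal_iUnion_fintype_le _).trans ?_) 1
    exact (Finset.sum_le_card_nsmul _ _ δ fun i _ => h i).trans_eq (nsmul_eq_mul _ _)
  · by_contra! hle
    exact hω (subset_toMeasurable _ _ (mem_iUnion.2 ⟨i, hle⟩))

lemma card_pairs_le (p : ℕ) : Fintype.card (Pairs p) ≤ p ^ 2 := by
  simpa [sq] using Fintype.card_subtype_le fun e : Fin p × Fin p => e.1 < e.2

lemma card_pairs_mul_exp_le {p : ℕ} (hp : 0 < p) :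
    Fintype.card (Pairs p) * (2 * Real.exp (-(3 * Real.log p))) ≤ 2 / p := by
  have hp' : (0 : ℝ) < p := Nat.cast_pos.2 hp
  have hcard : (Fintype.card (Pairs p) : ℝ) ≤ p ^ 2 := by exact_mod_cast card_pairs_le p
  have hexp : Real.exp (3 * Real.log p) = p ^ 3 := by
    rw [← Real.log_rpow hp', Real.exp_log (by positivity)]
    norm_cast
  rw [Real.exp_neg, hexp]
  calc (Fintype.card (Pairs p) : ℝ) * (2 * ((p : ℝ) ^ 3)⁻¹)
      ≤ (p : ℝ) ^ 2 * (2 * ((p : ℝ) ^ 3)⁻¹) := by gcongr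
    _ = 2 / p := by field_simp

theorem exists_event_gradSupNorm_le {𝒳 Ω : Type*} [MeasurableSpace 𝒳] [MeasurableSpace Ω]
    {ν : Measure 𝒳} {f : 𝒳 → ℝ} {φ : 𝒳 → 𝒳 → ℝ} {p n : ℕ} {θ : Param p} {σ ζ : ℝ}
    [NeZero (Measure.pi fun _ : Fin p => ν)] (hp : 0 < p) (hθ : θ ∈ interior (domain ν f φ))
    (hσ : 0 < σ) (hζ : 0 < ζ)
    (hsub : ∀ e, IsSubexponential (fun x => suffStat φ x e) (σ ^ 2) ζ (law ν f φ θ))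
    (hnζ : 6 * Real.log p / (σ ^ 2 * ζ ^ 2) < n) {P : Measure Ω} {X : Fin n → Ω → Fin p → 𝒳}
    (hX : ∀ i, HasLaw (X i) (law ν f φ θ) P) (hind : iIndepFun X P) :
    ∃ G, MeasurableSet G ∧ ENNReal.ofReal (1 - 2 / p) ≤ P G ∧
      ∀ ω ∈ G, gradSupNorm ν f φ (fun i => X i ω) θ ≤ σ * √(6 * Real.log p / n) := by
  have := hind.isProbabilityMeasure
  have := Real.log_natCast_nonneg p
  have hn' : (0 : ℝ) < n := lt_of_le_of_lt (by positivity) hnζ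
  have hn : 0 < n := Nat.cast_pos.1 hn'
  have hrange : σ * √(6 * Real.log p / n) ≤ σ ^ 2 * ζ := by
    rw [sq, mul_assoc]
    gcongr
    refine Real.sqrt_le_iff.2 ⟨by positivity, ?_⟩
    rw [div_le_iff₀ hn', mul_pow]
    exact ((div_lt_iff₀' (by positivity)).1 hnζ).le
  have hexp : n * (σ * √(6 * Real.log p / n)) ^ 2 / (2 * σ ^ 2) = 3 * Real.log p := by
    rw [mul_pow, Real.sq_sqrt (by positivity)]
    field_simp
    ring
  obtain ⟨G, hG, hPG, hlt⟩ := exists_measurableSet_forall_lt fun e : Pairs p =>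
    hexp ▸ (hsub e).measure_abs_integral_sub_sampleMean_ge_le (by positivity) hζ hX hind hn
      (by positivity) hrange
  refine ⟨G, hG, (ENNReal.ofReal_le_ofReal ?_).trans hPG, fun ω hω => ?_⟩
  · exact sub_le_sub_left (card_pairs_mul_exp_le hp) 1
  · rw [gradSupNorm_eq hn hθ]
    refine Real.iSup_le (fun e => ?_) (by positivity)
    rw [score_apply hθ]
    exact (hlt ω hω e).le

end Event

section Rate

variable {σ β c₀ k l n : ℝ}

lemma penalized_error_le (hβ : 0 < β) (hk : 0 ≤ k) {lam : ℝ}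
    (hlam : lam ≤ c₀ * (σ * √(6 * l / n))) :
    1.5 * lam * √k / β ≤ 1.5 * c₀ * β⁻¹ * σ * √(6 * k * l / n) := by
  have hsqrt : √(6 * k * l / n) = √k * √(6 * l / n) := by
    rw [← Real.sqrt_mul hk]
    congr 1
    ring
  calc 1.5 * lam * √k / β ≤ 1.5 * (c₀ * (σ * √(6 * l / n))) * √k / β := by gcongr
    _ = 1.5 * c₀ * β⁻¹ * σ * √(6 * k * l / n) := by rw [hsqrt]; ring

lemma rate_lt_radius {r : ℝ} (hr : 0 < r) (hk : 0 ≤ k) (hl : 0 ≤ l) (hn : 0 < n)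
    (h : 13.5 * c₀ ^ 2 * (r ^ 2)⁻¹ * (β ^ 2)⁻¹ * σ ^ 2 * k * l < n) :
    1.5 * c₀ * β⁻¹ * σ * √(6 * k * l / n) < r := by
  refine lt_of_pow_lt_pow_left₀ 2 hr.le ?_
  rw [mul_pow, Real.sq_sqrt (by positivity)]
  calc (1.5 * c₀ * β⁻¹ * σ) ^ 2 * (6 * k * l / n)
      = 13.5 * c₀ ^ 2 * (r ^ 2)⁻¹ * (β ^ 2)⁻¹ * σ ^ 2 * k * l * (r ^ 2 / n) := by
        field_simp
        norm_num
        ring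
    _ < n * (r ^ 2 / n) := by gcongr
    _ = r ^ 2 := by field_simp

end Rate

end SemiEFGM

theorem corollary1_general {𝒳 : Type u} [MeasurableSpace 𝒳] (ν : Measure 𝒳)
    (φ : 𝒳 → 𝒳 → ℝ) (f : 𝒳 → ℝ) (p : ℕ) (hp : 1 ≤ p) (θstar : SemiEFGM.Param p)
    (hmin : SemiEFGM.MinimalRepresentation ν f φ θstar)
    (hθ : θstar ∈ interior (SemiEFGM.domain ν f φ)) :
    ∃ σ ζ r β : ℝ, 0 < σ ∧ 0 < ζ ∧ 0 < r ∧ 0 < β ∧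
      ∀ c₀ : ℝ, 2 ≤ c₀ → ∀ n : ℕ,
        max (6 * Real.log p / (σ ^ 2 * ζ ^ 2))
            (13.5 * c₀ ^ 2 * (r ^ 2)⁻¹ * (β ^ 2)⁻¹ * σ ^ 2 * SemiEFGM.l0 θstar * Real.log p)
          < (n : ℝ) →
        ∀ (Ω : Type w) [MeasurableSpace Ω] (P : Measure Ω) [IsProbabilityMeasure P]
          (X : Fin n → Ω → (Fin p → 𝒳)),
          (∀ i, HasLaw (X i) (SemiEFGM.law ν f φ θstar) P) → iIndepFun X P →
          ∃ G : Set Ω, MeasurableSet G ∧ ENNReal.ofReal (1 - 2 / (p : ℝ)) ≤ P G ∧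
            ∀ ω ∈ G, ∀ lam : ℝ,
              2 * SemiEFGM.gradSupNorm ν f φ (fun i => X i ω) θstar ≤ lam →
              lam ≤ c₀ * SemiEFGM.gradSupNorm ν f φ (fun i => X i ω) θstar →
              (∃! θhat, SemiEFGM.IsJointEstimator ν f φ (fun i => X i ω) lam θhat) ∧
              ∀ θhat, SemiEFGM.IsJointEstimator ν f φ (fun i => X i ω) lam θhat →
                ‖θhat - θstar‖ ≤
                  1.5 * c₀ * β⁻¹ * σ *
                    Real.sqrt (6 * SemiEFGM.l0 θstar * Real.log p / n) := by
  have hlog : 0 ≤ Real.log p := Real.log_natCast_nonneg p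
  rcases eq_zero_or_neZero (Measure.pi fun _ : Fin p => ν) with h0 | _
  · refine ⟨1, 1, 1, 1, one_pos, one_pos, one_pos, one_pos, fun c₀ _ n hn Ω _ P _ X hX _ => ?_⟩
    have hn0 : 0 < n := Nat.cast_pos.1 ((le_max_of_le_left (by positivity)).trans_lt hn)
    have := (hX ⟨0, hn0⟩).isProbabilityMeasure_iff.1 ‹_›
    exact absurd (by simp [SemiEFGM.law, h0])
      (IsProbabilityMeasure.ne_zero (SemiEFGM.law ν f φ θstar))
  have := SemiEFGM.isProbabilityMeasure_law (interior_subset hθ)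
  obtain ⟨r, hr, β, hβ, hest⟩ := hmin.exists_jointEstimator_error_le hθ
  obtain ⟨σ, hσ, ζ, hζ, hsub⟩ := SemiEFGM.exists_forall_isSubexponential
    (SemiEFGM.zero_mem_interior_integrableExpSet_suffStat hθ)
  refine ⟨σ, ζ, r, β, hσ, hζ, hr, hβ, fun c₀ hc₀ n hn Ω _ P _ X hX hind => ?_⟩
  obtain ⟨hnζ, hnr⟩ := max_lt_iff.1 hn
  have hn0 : (0 : ℝ) < n := lt_of_le_of_lt (by positivity) hnζ
  obtain ⟨G, hG, hPG, hgrad⟩ :=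
    SemiEFGM.exists_event_gradSupNorm_le hp hθ hσ hζ hsub hnζ hX hind
  refine ⟨G, hG, hPG, fun ω hω lam hlo hhi => ?_⟩
  have hle := SemiEFGM.penalized_error_le hβ (Nat.cast_nonneg (SemiEFGM.l0 θstar))
    (hhi.trans (mul_le_mul_of_nonneg_left (hgrad ω hω) (by linarith)))
  have hlt := SemiEFGM.rate_lt_radius hr (Nat.cast_nonneg _) hlog hn0 hnr
  obtain ⟨hex, herr⟩ := hest n (Nat.cast_pos.1 hn0) _ lam hlo (hle.trans_lt hlt)
  exact ⟨hex, fun θhat h => (herr θhat h).trans hle⟩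

theorem corollary1 {𝒳 : Type u} [MeasurableSpace 𝒳] (ν : Measure 𝒳) [SigmaFinite ν]
    (φ : 𝒳 → 𝒳 → ℝ) (hφm : Measurable (Function.uncurry φ))
    (hφ : SemiEFGM.IsMercerKernel φ)
    (hint : ∀ c : ℝ, 0 < c → Integrable (fun x => Real.exp (-c * φ x x)) ν)
    (f : 𝒳 → ℝ) (hf : ∀ x, f x = -φ x x)
    (p : ℕ) (hp : 1 ≤ p) (θstar : SemiEFGM.Param p)
    (hmin : SemiEFGM.MinimalRepresentation ν f φ θstar)
    (hθ : ∀ e, |θstar e| ≤ 0.25)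
    (hreg : (∃ s, 8 ≤ SemiEFGM.degree θstar s) → θstar ∈ interior (SemiEFGM.domain ν f φ)) :
    ∃ σ ζ r β : ℝ, 0 < σ ∧ 0 < ζ ∧ 0 < r ∧ 0 < β ∧
      ∀ c₀ : ℝ, 2 ≤ c₀ → ∀ n : ℕ,
        max (6 * Real.log p / (σ ^ 2 * ζ ^ 2))
            (13.5 * c₀ ^ 2 * (r ^ 2)⁻¹ * (β ^ 2)⁻¹ * σ ^ 2 * SemiEFGM.l0 θstar * Real.log p)
          < (n : ℝ) →
        ∀ (Ω : Type w) [MeasurableSpace Ω] (P : Measure Ω) [IsProbabilityMeasure P]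
          (X : Fin n → Ω → (Fin p → 𝒳)),
          (∀ i, HasLaw (X i) (SemiEFGM.law ν f φ θstar) P) → iIndepFun X P →
          ∃ G : Set Ω, MeasurableSet G ∧ ENNReal.ofReal (1 - 2 / (p : ℝ)) ≤ P G ∧
            ∀ ω ∈ G, ∀ lam : ℝ,
              2 * SemiEFGM.gradSupNorm ν f φ (fun i => X i ω) θstar ≤ lam →
              lam ≤ c₀ * SemiEFGM.gradSupNorm ν f φ (fun i => X i ω) θstar →
              (∃! θhat, SemiEFGM.IsJointEstimator ν f φ (fun i => X i ω) lam θhat) ∧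
              ∀ θhat, SemiEFGM.IsJointEstimator ν f φ (fun i => X i ω) lam θhat →
                ‖θhat - θstar‖ ≤
                  1.5 * c₀ * β⁻¹ * σ *
                    Real.sqrt (6 * SemiEFGM.l0 θstar * Real.log p / n) := by
  exact corollary1_general ν φ f p hp θstar hmin <| by_cases hreg fun h =>
    SemiEFGM.mem_interior_domain_of_degree_lt hφm hφ hint hf hθ (by simpa using h)
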